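/- **Batch sizes for sampling without replacement (offline setting).** There is an absolute constant $C>0$ with the following property. Let $n\ge 0$, $p\ge 1$, $m\ge 1$ be integers, let $L_0,\dots,L_{p-1}>0$ and $L_p\in\mathbb R$, let $\kappa_1,\dots,\kappa_p>0$, $\varepsilon>0$ and $\delta\in(0,1]$. Then there are integers $N_1,\dots,N_p$, depending only on these parameters, such that for $i=1,\dots,p$ $$1\le N_i\le m,\qquad N_i\le\left\lceil C\,\log\!\left(\frac{2k_{0,i}^{\,ni}}{\delta}\right)\left(\frac{\kappa_i^2\,\varepsilon^{2(p-i+1)/p}}{L_{i-1}^2}+\frac1m\right)^{-1}\right\rceil,\qquad k_{0,i}=\frac{2i}{\log(3/2)}$$ (that is, $N_i=\tilde{\mathcal O}\big((\kappa_i^2\varepsilon^{2(p-i+1)/p}/L_{i-1}^2+1/m)^{-1}\big)$, where $\tilde{\mathcal O}$ hides an absolute constant, the factor $\log(2k_{0,i}^{\,ni}/\delta)$ and rounding up), and such that the following holds. Let $f=\frac1m\sum_{j=1}^m f_j$ be convex on $\mathbb R^n$, where each $f_j:\mathbb R^n\to\mathbb R$ is $p$ times differentiable. Let $x_0\in\mathbb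 R^n$ be such that the Lebesgue set $\mathcal L(x_0)=\{x: f(x)\le f(x_0)\}$ has non-empty interior (this is automatic if $x_0$ is not a minimizer of $f$), and assume that for all $j=1,\dots,m$, $i=0,\dots,p$ and $x,y\in\mathcal L(x_0)$ $$\|\nabla^i f_j(x)-\nabla^i f_j(y)\|\le L_i\|x-y\|,$$ where $\|T\|=\max_{\|s_1\|=\dots=\|s_i\|=1}|T[s_1,\dots,s_i]|$ and vectors carry the Euclidean norm. Let $x\in\mathcal L(x_0)$. For each $i=1,\dots,p$ let $\mathcal S_i$ be a random set of $N_i$ indices drawn uniformly without replacement from $\{1,\dots,m\}$ (the joint distribution of $\mathcal S_1,\dots,\mathcal S_p$ is arbitrary), and let $$G_{x,i}=\frac1{|\mathcal S_i|}\sum_{j\in\mathcal S_i}\nabla^i f_j(x).$$ Then, with probability at least $1-\delta$, $$\big\|(G_{x,i}-\nabla^i f(x))[s]^{i-1}\big\|\le\kappa_i\,\varepsilon^{(p-i+1)/p}\,\|s\|^{i-1}\qquad\text{for all } s\in\mathbb R^n \text{ and all } i=1,\dots,p .$$ -/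

import Mathlib

open MeasureTheory

noncomputable section

namespace TensorSampling

/-- `ℝⁿ` with the Euclidean norm. -/
abbrev Space (n : ℕ) : Type := EuclideanSpace ℝ (Fin n)

/-- The finite-sum objective `f(x) = (1/m) ∑ⱼ fⱼ(x)`. -/
def finiteSum {n m : ℕ} (f : Fin m → Space n → ℝ) (x : Space n) : ℝ :=
  (m : ℝ)⁻¹ * ∑ j, f j x

/-- The Lebesgue (sublevel) set `{x | g x ≤ g x₀}`. -/
def lebesgueSet {n : ℕ} (g : Space n → ℝ) (x₀ : Space n) : Set (Space n) :=
  {x | g x ≤ g x₀}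

/-- `g` is `p` times (Fréchet) differentiable on the whole space: the derivatives of orders
`0, …, p - 1` are differentiable everywhere, so that those of orders `0, …, p` exist. -/
def TimesDifferentiable {n : ℕ} (p : ℕ) (g : Space n → ℝ) : Prop :=
  ∀ i < p, Differentiable ℝ (iteratedFDeriv ℝ i g)

/-- The `i`-th derivative of `g` is Lipschitz continuous on `A` with constant `K`.  The norm is the
operator norm `max {|T[s₁, …, sᵢ]| : ‖s₁‖ = ⋯ = ‖sᵢ‖ = 1}` of multilinear forms. -/
def LipschitzDerivOn {n : ℕ} (i : ℕ) (K : ℝ) (g : Space n → ℝ) (A : Set (Space n)) : Prop :=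
  ∀ x ∈ A, ∀ y ∈ A, ‖iteratedFDeriv ℝ i g x - iteratedFDeriv ℝ i g y‖ ≤ K * ‖x - y‖

/-- The sampled derivative `G_{x,i} = |S|⁻¹ ∑_{j ∈ S} ∇ⁱ fⱼ(x)` for a sample set `S`. -/
def sampledDeriv {n m : ℕ} (f : Fin m → Space n → ℝ) (S : Finset (Fin m)) (i : ℕ) (x : Space n) :
    ContinuousMultilinearMap ℝ (fun _ : Fin i => Space n) ℝ :=
  (S.card : ℝ)⁻¹ • ∑ j ∈ S, iteratedFDeriv ℝ i (f j) x

/-- The inexactness condition at `x` for the approximations `G i` of the derivatives `∇ⁱ g(x)`: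
`‖(G i - ∇ⁱ g(x))[s]^{i-1}‖ ≤ κᵢ ε^{(p-i+1)/p} ‖s‖^{i-1}` for all `s` and all `i = 1, …, p`.
Here `i = k + 1`, and `T.curryRight (fun _ => s)` is the linear form `h ↦ T[s, …, s, h]`. -/
def InexactnessCondition {n : ℕ} (p : ℕ) (κ : ℕ → ℝ) (ε : ℝ) (g : Space n → ℝ) (x : Space n)
    (G : (i : ℕ) → ContinuousMultilinearMap ℝ (fun _ : Fin i => Space n) ℝ) : Prop :=
  ∀ k < p, ∀ s : Space n,
    ‖(G (k + 1) - iteratedFDeriv ℝ (k + 1) g x).curryRight (fun _ => s)‖ ≤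
      κ (k + 1) * ε ^ (((p : ℝ) - ((k + 1 : ℕ) : ℝ) + 1) / (p : ℝ)) * ‖s‖ ^ k

/-- The random set `S` is the outcome of drawing `N` indices from `{1, …, m}` uniformly without
replacement: every `N`-element set of indices has probability `1 / (m choose N)`. -/
structure IsSampleWithoutReplacement {Ω : Type*} [MeasurableSpace Ω] (μ : Measure Ω) {m : ℕ}
    (N : ℕ) (S : Ω → Finset (Fin m)) : Prop where
  measurableSet_eq : ∀ A : Finset (Fin m), MeasurableSet {ω | S ω = A}
  measure_eq : ∀ A : Finset (Fin m),
    μ {ω | S ω = A} = if A.card = N then ((m.choose N : ENNReal))⁻¹ else 0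

/-- The logarithmic factor `log (2 k₀^{n i} / δ)`, `k₀ = 2 i / log (3/2)`, for tensors of order `i`
on `ℝⁿ`; this factor is what the notation `Õ` hides. -/
def logFactor (n i : ℕ) (δ : ℝ) : ℝ :=
  Real.log (2 * (2 * (i : ℝ) / Real.log (3 / 2)) ^ (n * i) / δ)

/-- The order of the batch size for the `i`-th derivative,
`(κ² ε^{2(p-i+1)/p} / L² + 1/m)⁻¹`. -/
def batchOrder (p m i : ℕ) (L κ ε : ℝ) : ℝ :=
  (κ ^ 2 * ε ^ (2 * ((p : ℝ) - (i : ℝ) + 1) / (p : ℝ)) / L ^ 2 + 1 / (m : ℝ))⁻¹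

end TensorSampling

end

/-! A derivative `∇^{i-1} fⱼ` that is `L_{i-1}`-Lipschitz forces `‖∇ⁱ fⱼ(x)‖ ≤ L_{i-1}`, so each
sampled derivative averages bounded tensors and should concentrate (`norm_iteratedFDeriv_succ_le`).
For scalars, exponential Markov over all `N`-subsets turns the moment generating function into an
elementary symmetric sum of the numbers `exp (t (x j - c))`. Maclaurin's inequality
(`elemSymm_le_choose_mul_pow`) bounds it by the value for independent draws, which gives Hoeffding's
bound without replacement (`card_deviation_le`). A net of the unit ball and a union bound over its
`i`-tuples lift this to operator norms (`card_norm_deviation_le`). The logarithmic factor pays for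
the net and for a failure probability `δ / 2^i` at order `i`; these sum to less than `δ`. If the
batch is capped at `m`, the sample is exact. -/

namespace TensorSampling

/-! ### Maclaurin's inequality for elementary symmetric sums. -/

section SymmetricMeans

variable {ι : Type*} [Fintype ι] [DecidableEq ι]

/-- Double counting: deleting `i` matches pairs `i ∈ S` with pairs `i ∉ R`. The three identities on
symmetric sums below are instances. -/
lemma sum_powersetCard_succ_erase (k : ℕ) (F : Finset ι → ι → ℝ) :
    ∑ S ∈ Finset.powersetCard (k + 1) Finset.univ, ∑ i ∈ S, F (S.erase i) i =
      ∑ R ∈ Finset.powersetCard k Finset.univ, ∑ i ∈ Rᶜ, F R i := by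
  rw [Finset.sum_sigma', Finset.sum_sigma']
  refine Finset.sum_bij' (fun q _ => ⟨q.1.erase q.2, q.2⟩) (fun q _ => ⟨insert q.2 q.1, q.2⟩)
    ?_ ?_ ?_ ?_ ?_
  · rintro ⟨S, i⟩ h
    simp only [Finset.mem_sigma, Finset.mem_powersetCard_univ] at h
    simp [Finset.card_erase_of_mem h.2, h.1]
  · rintro ⟨R, i⟩ h
    simp only [Finset.mem_sigma, Finset.mem_powersetCard_univ, Finset.mem_compl] at h
    simp [Finset.card_insert_of_notMem h.2, h.1]
  · rintro ⟨S, i⟩ h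
    simp only [Finset.mem_sigma] at h
    simp [Finset.insert_erase h.2]
  · rintro ⟨R, i⟩ h
    simp only [Finset.mem_sigma, Finset.mem_compl] at h
    simp [Finset.erase_insert h.2]
  · rintro ⟨S, i⟩ _
    rfl

/-- The elementary symmetric sum of order `k` of a finite family. -/
def elemSymm (a : ι → ℝ) (k : ℕ) : ℝ :=
  ∑ S ∈ Finset.powersetCard k Finset.univ, ∏ j ∈ S, a j

lemma succ_mul_elemSymm_succ (a : ι → ℝ) (k : ℕ) :
    ((k : ℝ) + 1) * elemSymm a (k + 1) =
      ∑ R ∈ Finset.powersetCard k Finset.univ, (∏ j ∈ R, a j) * ∑ i ∈ Rᶜ, a i := by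
  have h := sum_powersetCard_succ_erase k (fun R i => (∏ j ∈ R, a j) * a i)
  simp only [← Finset.mul_sum] at h
  rw [← h, elemSymm, Finset.mul_sum]
  refine Finset.sum_congr rfl fun S hS => ?_
  rw [Finset.sum_congr rfl fun i hi => Finset.prod_erase_mul S a hi, Finset.sum_const,
    (Finset.mem_powersetCard_univ.1 hS), nsmul_eq_mul]
  push_cast
  ring

lemma sum_prod_mul_sum_sq (a : ι → ℝ) (k : ℕ) :
    ∑ S ∈ Finset.powersetCard (k + 1) Finset.univ, (∏ j ∈ S, a j) * ∑ i ∈ S, a i =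
      ∑ R ∈ Finset.powersetCard k Finset.univ, (∏ j ∈ R, a j) * ∑ i ∈ Rᶜ, a i ^ 2 := by
  have h := sum_powersetCard_succ_erase k (fun R i => (∏ j ∈ R, a j) * a i ^ 2)
  simp only [← Finset.mul_sum] at h
  rw [← h]
  refine Finset.sum_congr rfl fun S _ => ?_
  rw [Finset.mul_sum]
  refine Finset.sum_congr rfl fun i hi => ?_
  rw [← Finset.prod_erase_mul S a hi]
  ring

lemma succ_mul_sum_prod_mul_sum_compl (a : ι → ℝ) (k : ℕ) :
    ((k : ℝ) + 1) * ∑ S ∈ Finset.powersetCard (k + 1) Finset.univ,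
        (∏ j ∈ S, a j) * ∑ i ∈ Sᶜ, a i =
      ∑ R ∈ Finset.powersetCard k Finset.univ,
        (∏ j ∈ R, a j) * ((∑ i ∈ Rᶜ, a i) ^ 2 - ∑ i ∈ Rᶜ, a i ^ 2) := by
  have h := sum_powersetCard_succ_erase k
    (fun R i => (∏ j ∈ R, a j) * (a i * (∑ l ∈ Rᶜ, a l - a i)))
  simp only [← Finset.mul_sum] at h
  have h' : ∀ R : Finset ι, ∑ i ∈ Rᶜ, a i * (∑ l ∈ Rᶜ, a l - a i) =
      (∑ i ∈ Rᶜ, a i) ^ 2 - ∑ i ∈ Rᶜ, a i ^ 2 := fun R => by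
    simp only [mul_sub, Finset.sum_sub_distrib, ← Finset.sum_mul, sq]
  simp only [h'] at h
  rw [← h, Finset.mul_sum]
  refine Finset.sum_congr rfl fun S hS => ?_
  have hc : ∀ i ∈ S, (∏ j ∈ S.erase i, a j) * (a i * (∑ l ∈ (S.erase i)ᶜ, a l - a i)) =
      (∏ j ∈ S, a j) * ∑ l ∈ Sᶜ, a l := fun i hi => by
    rw [← Finset.prod_erase_mul S a hi, Finset.compl_erase, Finset.sum_insert (by simpa using hi)]
    ring
  rw [Finset.sum_congr rfl hc, Finset.sum_const, (Finset.mem_powersetCard_univ.1 hS), nsmul_eq_mul]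
  push_cast
  ring

/-- Split `(∑ a) * elemSymm a (k+1)` as `X + Y`, where the extra index lies outside or inside `S`;
then `X = (k+2) * elemSymm a (k+2)`. Cauchy-Schwarz on each `Rᶜ`, of size `m - k` with `m =
Fintype.card ι`, gives `(k+1) X ≤ (m-k-1) Y`. Adding `(m-k-1) X` to both sides gives the claim. -/
lemma elemSymm_step (a : ι → ℝ) (ha : ∀ i, 0 ≤ a i) (k : ℕ) :
    (Fintype.card ι : ℝ) * ((k + 2 : ℝ) * elemSymm a (k + 2)) ≤
      ((Fintype.card ι : ℝ) - (k + 1)) * ((∑ i, a i) * elemSymm a (k + 1)) := by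
  have h1 := succ_mul_elemSymm_succ a (k + 1)
  have h2 := sum_prod_mul_sum_sq a k
  have h3 := succ_mul_sum_prod_mul_sum_compl a k
  have h4 : ∑ S ∈ Finset.powersetCard (k + 1) Finset.univ, (∏ j ∈ S, a j) * ∑ i ∈ Sᶜ, a i =
      (∑ i, a i) * elemSymm a (k + 1) -
        ∑ S ∈ Finset.powersetCard (k + 1) Finset.univ, (∏ j ∈ S, a j) * ∑ i ∈ S, a i := by
    rw [elemSymm, Finset.mul_sum, ← Finset.sum_sub_distrib]
    refine Finset.sum_congr rfl fun S _ => ?_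
    rw [← Finset.sum_add_sum_compl S a]
    ring
  have h5 : ∑ R ∈ Finset.powersetCard k Finset.univ,
        (∏ j ∈ R, a j) * ((∑ i ∈ Rᶜ, a i) ^ 2 - ∑ i ∈ Rᶜ, a i ^ 2) ≤
      ((Fintype.card ι : ℝ) - k - 1) * ∑ R ∈ Finset.powersetCard k Finset.univ,
        (∏ j ∈ R, a j) * ∑ i ∈ Rᶜ, a i ^ 2 := by
    rw [Finset.mul_sum]
    refine Finset.sum_le_sum fun R hR => ?_
    have hcs := sq_sum_le_card_mul_sum_sq (s := Rᶜ) (f := a)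
    have hcard : ((Rᶜ).card : ℝ) = (Fintype.card ι : ℝ) - k := by
      rw [Finset.card_compl, Nat.cast_sub (Finset.card_le_univ R),
        Finset.mem_powersetCard_univ.1 hR]
    rw [hcard] at hcs
    have := mul_le_mul_of_nonneg_left hcs (Finset.prod_nonneg fun j (_ : j ∈ R) => ha j)
    linarith
  push_cast at h1
  have e : ((k : ℝ) + 2) = k + 1 + 1 := by ring
  rw [e, h1]
  rw [← h3, ← h2] at h5
  rw [h4] at h5 ⊢
  linarith

/-- A weak form of Maclaurin's inequality. -/
lemma elemSymm_le_choose_mul_pow [Nonempty ι] (a : ι → ℝ) (ha : ∀ i, 0 ≤ a i) (k : ℕ) :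
    elemSymm a k ≤ ((Fintype.card ι).choose k : ℝ) *
      ((Fintype.card ι : ℝ)⁻¹ * ∑ i, a i) ^ k := by
  have hm : (0 : ℝ) < Fintype.card ι := by exact_mod_cast Fintype.card_pos
  have hs : 0 ≤ ∑ i, a i := Finset.sum_nonneg fun i _ => ha i
  induction k with
  | zero => simp [elemSymm]
  | succ k ih =>
    cases k with
    | zero =>
      have := succ_mul_elemSymm_succ a 0
      simp at this
      simp [this, hm.ne']
    | succ k =>
      by_cases hk : Fintype.card ι < k + 1 + 1
      · rw [elemSymm, Finset.powersetCard_eq_empty.2 (by simpa using hk), Finset.sum_empty]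
        positivity
      push Not at hk
      have hk' : (k : ℝ) + 1 + 1 ≤ Fintype.card ι := by exact_mod_cast hk
      have hstep := elemSymm_step a ha k
      have hch : ((Fintype.card ι).choose (k + 1 + 1) : ℝ) * (k + 2) =
          (Fintype.card ι).choose (k + 1) * ((Fintype.card ι : ℝ) - (k + 1)) := by
        have := Nat.choose_succ_right_eq (Fintype.card ι) (k + 1)
        have h' := congrArg (Nat.cast (R := ℝ)) this
        rw [Nat.cast_mul, Nat.cast_mul, Nat.cast_sub (by omega)] at h'
        push_cast at h'
        linarith
      have h1 := mul_le_mul_of_nonneg_left (mul_le_mul_of_nonneg_left ih hs)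
        (by linarith : 0 ≤ (Fintype.card ι : ℝ) - (k + 1))
      refine le_of_mul_le_mul_left (a := (Fintype.card ι : ℝ) * (k + 2)) ?_ (by positivity)
      calc (Fintype.card ι : ℝ) * (k + 2) * elemSymm a (k + 1 + 1)
          ≤ ((Fintype.card ι : ℝ) - (k + 1)) * ((∑ i, a i) *
            (((Fintype.card ι).choose (k + 1) : ℝ) *
              ((Fintype.card ι : ℝ)⁻¹ * ∑ i, a i) ^ (k + 1))) := by
            rw [mul_assoc]; exact hstep.trans h1
        _ = (∑ i, a i) * ((Fintype.card ι : ℝ)⁻¹ * ∑ i, a i) ^ (k + 1) *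
            ((Fintype.card ι).choose (k + 1) * ((Fintype.card ι : ℝ) - (k + 1))) := by ring
        _ = _ := by
          rw [← hch, pow_succ _ (k + 1)]
          field_simp

end SymmetricMeans

/-! ### Scalar concentration for sampling without replacement. -/

section Hoeffding

/-- By convexity `exp` lies below its chord on `[-tD, tD]`; the linear term averages to zero,
leaving `cosh (t D)`. -/
lemma mean_exp_le {ι : Type*} [Fintype ι] [Nonempty ι] (y : ι → ℝ) {D : ℝ} (hD : 0 < D) (hy : ∀ j, |y j| ≤ D) (h0 : ∑ j, y j = 0)
    (t : ℝ) :
    (Fintype.card ι : ℝ)⁻¹ * ∑ j, Real.exp (t * y j) ≤ Real.exp ((t * D) ^ 2 / 2) := by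
  have hm : (0 : ℝ) < Fintype.card ι := by exact_mod_cast Fintype.card_pos
  have h : ∑ j, Real.exp (t * y j) ≤ Fintype.card ι * Real.cosh (t * D) := by
    calc ∑ j, Real.exp (t * y j)
        ≤ ∑ j, (Real.cosh (t * D) + y j / D * Real.sinh (t * D)) := by
          refine Finset.sum_le_sum fun j _ => ?_
          have := Real.exp_mul_le_cosh_add_mul_sinh (t := y j / D)
            (by rw [abs_div, abs_of_pos hD]; exact (div_le_one hD).2 (hy j)) (t * D)
          rwa [show y j / D * (t * D) = t * y j by field_simp] at this
      _ = _ := by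
          rw [Finset.sum_add_distrib, ← Finset.sum_mul, ← Finset.sum_div, h0]
          simp
  calc _ ≤ (Fintype.card ι : ℝ)⁻¹ * (Fintype.card ι * Real.cosh (t * D)) := by gcongr
    _ = Real.cosh (t * D) := by field_simp
    _ ≤ _ := Real.cosh_le_exp_half_sq _

variable {ι : Type*} [Fintype ι] [DecidableEq ι] [Nonempty ι]

/-- Hoeffding's inequality for sampling without replacement, one-sided, in counting form. -/
lemma card_deviation_le (x : ι → ℝ) {B u : ℝ} (hB : 0 < B) (hu : 0 ≤ u) (hx : ∀ j, |x j| ≤ B)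
    {N : ℕ} (hN : 1 ≤ N) :
    (((Finset.powersetCard N Finset.univ).filter fun S : Finset ι =>
        u ≤ (N : ℝ)⁻¹ * ∑ j ∈ S, x j - (Fintype.card ι : ℝ)⁻¹ * ∑ j, x j).card : ℝ) ≤
      (Fintype.card ι).choose N * Real.exp (-(N * u ^ 2 / (8 * B ^ 2))) := by
  have hm : (0 : ℝ) < Fintype.card ι := by exact_mod_cast Fintype.card_pos
  have hN' : (0 : ℝ) < N := by exact_mod_cast hN
  set c := (Fintype.card ι : ℝ)⁻¹ * ∑ j, x j with hc
  -- Minimizes the exponent `-t N u + 2 N B² t²`; the centred values are bounded by `2 * B`.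
  set t := u / (4 * B ^ 2) with ht
  have ht0 : 0 ≤ t := by positivity
  have hcB : |c| ≤ B := by
    rw [hc, abs_mul, abs_of_pos (inv_pos.2 hm), inv_mul_le_iff₀ hm]
    refine (Finset.abs_sum_le_sum_abs _ _).trans ?_
    refine (Finset.sum_le_sum fun j _ => hx j).trans ?_
    simp
  have hmean := mean_exp_le (fun j => x j - c) (D := 2 * B) (by positivity)
    (fun j => (abs_sub _ _).trans (by linarith [hx j])) (by
      simp only [Finset.sum_sub_distrib, Finset.sum_const, Finset.card_univ, nsmul_eq_mul, hc]
      field_simp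
      ring) t
  -- This replaces the factorization that independence would provide.
  have hmac := elemSymm_le_choose_mul_pow (fun j => Real.exp (t * (x j - c)))
    (fun j => (Real.exp_pos _).le) N
  set P := Finset.powersetCard N (Finset.univ : Finset ι)
  set Q := P.filter fun S : Finset ι => u ≤ (N : ℝ)⁻¹ * ∑ j ∈ S, x j - c
  have hlow : (Q.card : ℝ) * Real.exp (t * (N * u)) ≤
      elemSymm (fun j => Real.exp (t * (x j - c))) N := by
    rw [← nsmul_eq_mul, ← Finset.sum_const, elemSymm]
    refine (Finset.sum_le_sum fun S hS => ?_).trans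
      (Finset.sum_le_sum_of_subset_of_nonneg (Finset.filter_subset _ _)
        fun S _ _ => Finset.prod_nonneg fun j _ => (Real.exp_pos _).le)
    obtain ⟨hS1, hS2⟩ := Finset.mem_filter.1 hS
    rw [← Real.exp_sum, ← Finset.mul_sum, Finset.sum_sub_distrib, Finset.sum_const,
      Finset.mem_powersetCard_univ.1 hS1, nsmul_eq_mul]
    refine Real.exp_le_exp.2 (mul_le_mul_of_nonneg_left ?_ ht0)
    have := mul_le_mul_of_nonneg_left hS2 hN'.le
    rw [mul_sub, mul_inv_cancel_left₀ hN'.ne'] at this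
    exact this
  have hpow : ((Fintype.card ι : ℝ)⁻¹ * ∑ j, Real.exp (t * (x j - c))) ^ N ≤
      Real.exp (N * ((t * (2 * B)) ^ 2 / 2)) := by
    rw [Real.exp_nat_mul]
    exact pow_le_pow_left₀ (by positivity) hmean N
  refine le_of_mul_le_mul_right (a := Real.exp (t * (N * u))) ?_ (Real.exp_pos _)
  rw [mul_assoc, ← Real.exp_add]
  refine hlow.trans (hmac.trans ?_)
  refine mul_le_mul_of_nonneg_left (hpow.trans (Real.exp_le_exp.2 (le_of_eq ?_))) (by positivity)
  rw [ht]
  field_simp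
  ring

lemma card_abs_deviation_le (x : ι → ℝ) {B u : ℝ} (hB : 0 < B) (hu : 0 ≤ u)
    (hx : ∀ j, |x j| ≤ B) {N : ℕ} (hN : 1 ≤ N) :
    (((Finset.powersetCard N Finset.univ).filter fun S : Finset ι =>
        u ≤ |(N : ℝ)⁻¹ * ∑ j ∈ S, x j - (Fintype.card ι : ℝ)⁻¹ * ∑ j, x j|).card : ℝ) ≤
      (Fintype.card ι).choose N * (2 * Real.exp (-(N * u ^ 2 / (8 * B ^ 2)))) := by
  have h1 := card_deviation_le x hB hu hx hN
  have h2 := card_deviation_le (fun j => -x j) hB hu (fun j => by simpa using hx j) hN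
  refine le_trans ?_ ((add_le_add h1 h2).trans (le_of_eq (by ring)))
  rw [← Nat.cast_add, Nat.cast_le]
  refine (Finset.card_le_card fun S hS => ?_).trans (Finset.card_union_le _ _)
  simp only [Finset.mem_union, Finset.mem_filter, Finset.sum_neg_distrib, mul_neg] at hS ⊢
  rcases le_abs.1 hS.2 with h | h
  · exact Or.inl ⟨hS.1, h⟩
  · exact Or.inr ⟨hS.1, by linarith⟩

end Hoeffding

end TensorSampling

namespace TensorSampling

/-! ### Nets of the unit ball and concentration in operator norm. -/

section Net

open Module Metric in
/-- Volume bound for the size of an `r`-separated subset of the unit ball. -/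
lemma card_le_of_separated_unit {E : Type*} [NormedAddCommGroup E] [NormedSpace ℝ E]
    [FiniteDimensional ℝ E] (s : Finset E) {r : ℝ} (hr : 0 < r) (hs : ∀ c ∈ s, ‖c‖ ≤ 1)
    (h : ∀ c ∈ s, ∀ d ∈ s, c ≠ d → r ≤ ‖c - d‖) :
    (s.card : ℝ) ≤ (1 + 2 / r) ^ finrank ℝ E := by
  borelize E
  let μ : Measure E := Measure.addHaar
  set δ : ℝ := r / 2 with hδ
  set ρ : ℝ := 1 + r / 2 with hρ
  have δpos : 0 < δ := by positivity
  have ρpos : 0 < ρ := by positivity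
  set A := ⋃ c ∈ s, ball (c : E) δ with hA
  have D : Set.Pairwise (s : Set E) (Function.onFun Disjoint fun c => ball (c : E) δ) := by
    rintro c hc d hd hcd
    apply ball_disjoint_ball
    rw [dist_eq_norm]
    linarith [h c hc d hd hcd]
  have A_subset : A ⊆ ball (0 : E) ρ := by
    refine Set.iUnion₂_subset fun x hx => ?_
    apply ball_subset_ball'
    rw [dist_zero_right]
    linarith [hs x hx]
  have I : (s.card : ENNReal) * ENNReal.ofReal (δ ^ finrank ℝ E) * μ (ball 0 1) ≤
      ENNReal.ofReal (ρ ^ finrank ℝ E) * μ (ball 0 1) :=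
    calc
      (s.card : ENNReal) * ENNReal.ofReal (δ ^ finrank ℝ E) * μ (ball 0 1) = μ A := by
        rw [hA, measure_biUnion_finset D fun c _ => measurableSet_ball]
        simp only [μ.addHaar_ball_of_pos _ δpos]
        simp only [Finset.sum_const, nsmul_eq_mul, mul_assoc]
      _ ≤ μ (ball (0 : E) ρ) := measure_mono A_subset
      _ = ENNReal.ofReal (ρ ^ finrank ℝ E) * μ (ball 0 1) := by
        simp only [μ.addHaar_ball_of_pos _ ρpos]
  have J : (s.card : ENNReal) * ENNReal.ofReal (δ ^ finrank ℝ E) ≤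
      ENNReal.ofReal (ρ ^ finrank ℝ E) :=
    (ENNReal.mul_le_mul_iff_left (measure_ball_pos _ _ zero_lt_one).ne' measure_ball_lt_top.ne).1 I
  have K := ENNReal.toReal_le_of_le_ofReal (pow_nonneg ρpos.le _) J
  rw [ENNReal.toReal_mul, ENNReal.toReal_natCast, ENNReal.toReal_ofReal (by positivity)] at K
  rw [← le_div_iff₀ (by positivity), ← div_pow] at K
  have e : 1 + 2 / r = ρ / δ := by
    rw [hρ, hδ]
    field_simp
    ring
  rwa [e]

open Module in
lemma exists_net_unit_ball (E : Type*) [NormedAddCommGroup E] [NormedSpace ℝ E]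
    [FiniteDimensional ℝ E] {r : ℝ} (hr : 0 < r) :
    ∃ s : Finset E, (s.card : ℝ) ≤ (1 + 2 / r) ^ finrank ℝ E ∧ (∀ c ∈ s, ‖c‖ ≤ 1) ∧
      ∀ v : E, ‖v‖ ≤ 1 → ∃ c ∈ s, ‖v - c‖ ≤ r := by
  classical
  -- A separated set of largest cardinality is a net: an uncovered point could be added to it.
  let P : ℕ → Prop := fun k => ∃ s : Finset E, s.card = k ∧ (∀ c ∈ s, ‖c‖ ≤ 1) ∧
    ∀ c ∈ s, ∀ d ∈ s, c ≠ d → r ≤ ‖c - d‖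
  obtain ⟨b, hb⟩ := exists_nat_ge ((1 + 2 / r) ^ finrank ℝ E)
  have hP0 : P 0 := ⟨∅, by simp⟩
  have hPb : ∀ k, P k → k ≤ b := by
    rintro k ⟨s, rfl, h1, h2⟩
    exact_mod_cast (card_le_of_separated_unit s hr h1 h2).trans hb
  obtain ⟨s, hcard, h1, h2⟩ := Nat.findGreatest_spec (P := P) (Nat.zero_le b) hP0
  refine ⟨s, card_le_of_separated_unit s hr h1 h2, h1, fun v hv => ?_⟩
  by_contra! hcon
  have hvs : v ∉ s := fun hvs => by simpa using (hr.trans (hcon v hvs))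
  have hP : P (s.card + 1) := by
    refine ⟨insert v s, Finset.card_insert_of_notMem hvs, ?_, ?_⟩
    · intro c hc
      rcases Finset.mem_insert.1 hc with rfl | hc
      exacts [hv, h1 c hc]
    · intro c hc d hd hcd
      rcases Finset.mem_insert.1 hc with hc' | hc' <;>
        rcases Finset.mem_insert.1 hd with hd' | hd'
      · exact absurd (hc'.trans hd'.symm) hcd
      · rw [hc']; exact (hcon d hd').le
      · rw [hd', norm_sub_rev]; exact (hcon c hc').le
      · exact h2 c hc' d hd' hcd
  have := Nat.le_findGreatest (hPb _ hP) hP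
  omega

/-- A multilinear form is controlled by its values on tuples from a fine enough net. -/
lemma norm_multilinear_le_of_net {E : Type*} [NormedAddCommGroup E] [NormedSpace ℝ E]
    {i : ℕ} (hi : 1 ≤ i) {s : Finset E}
    (hs : ∀ c ∈ s, ‖c‖ ≤ 1) (hnet : ∀ v : E, ‖v‖ ≤ 1 → ∃ c ∈ s, ‖v - c‖ ≤ 1 / (2 * i))
    (T : ContinuousMultilinearMap ℝ (fun _ : Fin i => E) ℝ) {u : ℝ} (hu : 0 ≤ u)
    (hT : ∀ v ∈ Fintype.piFinset fun _ : Fin i => s, |T v| ≤ u) : ‖T‖ ≤ 2 * u := by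
  have hi' : (0 : ℝ) < i := by exact_mod_cast hi
  -- Moving all `i` arguments by at most `1 / (2 i)` changes `T` by at most `‖T‖ / 2`, which is
  -- later absorbed on the left.
  have hball : ∀ v : Fin i → E, (∀ j, ‖v j‖ ≤ 1) → |T v| ≤ u + ‖T‖ / 2 := by
    intro v hv
    choose c hcs hc using fun j => hnet (v j) (hv j)
    have h1 := hT c (Fintype.mem_piFinset.2 hcs)
    have h2 := T.norm_image_sub_le v c
    have hmax : max ‖v‖ ‖c‖ ≤ 1 := max_le ((pi_norm_le_iff_of_nonneg zero_le_one).2 hv)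
      ((pi_norm_le_iff_of_nonneg zero_le_one).2 fun j => hs _ (hcs j))
    have hvc : ‖v - c‖ ≤ 1 / (2 * i) := (pi_norm_le_iff_of_nonneg (by positivity)).2 hc
    have h3 : ‖T‖ * (Fintype.card (Fin i) : ℝ) * max ‖v‖ ‖c‖ ^ (Fintype.card (Fin i) - 1) *
        ‖v - c‖ ≤ ‖T‖ * i * 1 * (1 / (2 * i)) := by
      rw [Fintype.card_fin]
      gcongr
      exact pow_le_one₀ (by positivity) hmax
    have h4 : ‖T‖ * i * 1 * (1 / (2 * i)) = ‖T‖ / 2 := by field_simp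
    rw [Real.norm_eq_abs] at h2
    have h5 := abs_add_le (T v - T c) (T c)
    rw [sub_add_cancel] at h5
    linarith
  have hbound : ‖T‖ ≤ u + ‖T‖ / 2 := by
    refine T.opNorm_le_bound (by positivity) fun v => ?_
    by_cases hv : ∃ j, v j = 0
    · obtain ⟨j, hj⟩ := hv
      rw [T.map_coord_zero j hj, norm_zero]
      positivity
    push Not at hv
    have hw := hball (fun j => (‖v j‖)⁻¹ • v j) fun j => by
      rw [norm_smul, norm_inv, norm_norm, inv_mul_cancel₀ (norm_ne_zero_iff.2 (hv j))]
    have hpos : 0 < ∏ j, ‖v j‖ := Finset.prod_pos fun j _ => norm_pos_iff.2 (hv j)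
    rw [T.map_smul_univ, smul_eq_mul, abs_mul, Finset.prod_inv_distrib,
      abs_of_pos (inv_pos.2 hpos), inv_mul_le_iff₀ hpos] at hw
    rw [Real.norm_eq_abs]
    linarith
  linarith

open Module in
/-- Concentration in operator norm of the average of multilinear forms over a sample drawn
without replacement, in counting form. -/
lemma card_norm_deviation_le {E : Type*} [NormedAddCommGroup E] [NormedSpace ℝ E]
    [FiniteDimensional ℝ E] {ι : Type*} [Fintype ι] [DecidableEq ι] [Nonempty ι] {i : ℕ}
    (hi : 1 ≤ i) (A : ι → ContinuousMultilinearMap ℝ (fun _ : Fin i => E) ℝ) {B t : ℝ}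
    (hB : 0 < B) (ht : 0 ≤ t) (hA : ∀ j, ‖A j‖ ≤ B) {N : ℕ} (hN : 1 ≤ N) :
    (((Finset.powersetCard N Finset.univ).filter fun S : Finset ι =>
        t < ‖(N : ℝ)⁻¹ • ∑ j ∈ S, A j - (Fintype.card ι : ℝ)⁻¹ • ∑ j, A j‖).card : ℝ) ≤
      (Fintype.card ι).choose N *
        (2 * (1 + 4 * (i : ℝ)) ^ (finrank ℝ E * i) *
          Real.exp (-(N * t ^ 2 / (32 * B ^ 2)))) := by
  classical
  have hi' : (0 : ℝ) < i := by exact_mod_cast hi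
  obtain ⟨s, hcard, hs, hnet⟩ := exists_net_unit_ball E (r := 1 / (2 * (i : ℝ))) (by positivity)
  have hr : 1 + 2 / (1 / (2 * (i : ℝ))) = 1 + 4 * i := by field_simp; ring
  rw [hr] at hcard
  set V := Fintype.piFinset fun _ : Fin i => s
  have hV : (V.card : ℝ) ≤ (1 + 4 * (i : ℝ)) ^ (finrank ℝ E * i) := by
    rw [Fintype.card_piFinset_const, pow_mul, Nat.cast_pow]
    exact pow_le_pow_left₀ (by positivity) hcard i
  set P := Finset.powersetCard N (Finset.univ : Finset ι)
  -- The threshold `t / 2` offsets the factor 2 lost to the net and turns the 8 of the scalar bound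
  -- into 32.
  let Q : (Fin i → E) → Finset (Finset ι) := fun v => P.filter fun S =>
    t / 2 ≤ |(N : ℝ)⁻¹ * ∑ j ∈ S, A j v - (Fintype.card ι : ℝ)⁻¹ * ∑ j, A j v|
  have hQ : ∀ v ∈ V, ((Q v).card : ℝ) ≤ (Fintype.card ι).choose N *
      (2 * Real.exp (-(N * t ^ 2 / (32 * B ^ 2)))) := by
    intro v hv
    have hx : ∀ j, |A j v| ≤ B := fun j => by
      refine ((A j).le_opNorm v).trans ?_
      refine (mul_le_mul (hA j) (Finset.prod_le_one (fun _ _ => norm_nonneg _)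
        fun l _ => hs _ (Fintype.mem_piFinset.1 hv l)) (by positivity) hB.le).trans (by simp)
    refine (card_abs_deviation_le (fun j => A j v) hB (by positivity : 0 ≤ t / 2) hx hN).trans
      (le_of_eq ?_)
    rw [show N * (t / 2) ^ 2 / (8 * B ^ 2) = N * t ^ 2 / (32 * B ^ 2) by field_simp; ring]
  have hsub : (P.filter fun S : Finset ι =>
      t < ‖(N : ℝ)⁻¹ • ∑ j ∈ S, A j - (Fintype.card ι : ℝ)⁻¹ • ∑ j, A j‖) ⊆ V.biUnion Q := by
    intro S hS
    obtain ⟨hS1, hS2⟩ := Finset.mem_filter.1 hS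
    by_contra hcon
    simp only [Finset.mem_biUnion, not_exists, not_and] at hcon
    refine absurd hS2 (not_lt.2 ?_)
    refine (norm_multilinear_le_of_net hi hs hnet _ (u := t / 2) (by positivity)
      fun v hv => ?_).trans (by linarith)
    have h := hcon v hv
    simp only [Q, Finset.mem_filter, hS1, true_and, not_le] at h
    simpa [sum_apply] using h.le
  have h1 : ((V.biUnion Q).card : ℝ) ≤ ∑ v ∈ V, ((Q v).card : ℝ) := by
    exact_mod_cast Finset.card_biUnion_le
  refine (Nat.cast_le.2 (Finset.card_le_card hsub)).trans (h1.trans ?_)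
  refine (Finset.sum_le_sum hQ).trans ?_
  rw [Finset.sum_const, nsmul_eq_mul]
  refine (mul_le_mul_of_nonneg_right hV (by positivity)).trans (le_of_eq (by ring))

end Net

/-! ### Derivatives of finite sums, and their bounds from Lipschitz constants. -/

section Derivatives

variable {n : ℕ}

/-- The top derivative need not be continuous, so the induction uses differentiability alone. -/
lemma iteratedFDeriv_smul_sum {ι : Type*} [Fintype ι] {p : ℕ} (c : ℝ)
    (f : ι → Space n → ℝ) (hf : ∀ j, TimesDifferentiable p (f j)) :
    ∀ i ≤ p, ∀ x, iteratedFDeriv ℝ i (fun y => c * ∑ j, f j y) x =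
      c • ∑ j, iteratedFDeriv ℝ i (f j) x := by
  intro i
  induction i with
  | zero =>
    intro _ x
    ext v
    simp
  | succ i ih =>
    intro hi x
    have hfun : iteratedFDeriv ℝ i (fun y => c * ∑ j, f j y) =
        fun x => c • ∑ j, iteratedFDeriv ℝ i (f j) x := funext (ih (by omega))
    have hd : ∀ j, DifferentiableAt ℝ (iteratedFDeriv ℝ i (f j)) x := fun j => hf j i (by omega) x
    ext v
    rw [iteratedFDeriv_succ_apply_left, hfun]
    have hs : HasFDerivAt (fun x => c • ∑ j, iteratedFDeriv ℝ i (f j) x)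
        (c • ∑ j, fderiv ℝ (iteratedFDeriv ℝ i (f j)) x) x :=
      (HasFDerivAt.fun_sum fun j _ => (hd j).hasFDerivAt).const_smul c
    rw [hs.fderiv]
    simp [iteratedFDeriv_succ_apply_left]

/-- If the `i`-th derivative is Lipschitz on a convex set with non-empty interior and the next one
is Lipschitz too, the Lipschitz constant bounds the next derivative on the whole set. -/
lemma norm_iteratedFDeriv_succ_le {g : Space n → ℝ} {A : Set (Space n)} (hA : Convex ℝ A)
    (hint : (interior A).Nonempty) {i : ℕ} {K K' : ℝ} (hK : 0 ≤ K)
    (h1 : LipschitzDerivOn i K g A) (h2 : LipschitzDerivOn (i + 1) K' g A)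
    {x : Space n} (hx : x ∈ A) : ‖iteratedFDeriv ℝ (i + 1) g x‖ ≤ K := by
  have hin : ∀ y ∈ interior A, ‖iteratedFDeriv ℝ (i + 1) g y‖ ≤ K := by
    intro y hy
    rw [← norm_fderiv_iteratedFDeriv]
    refine norm_fderiv_le_of_lip' ℝ hK ?_
    filter_upwards [mem_interior_iff_mem_nhds.1 hy] with z hz
    exact h1 z hz y (interior_subset hy)
  -- The derivative test works only at interior points. Convexity makes these dense in `A`, and the
  -- Lipschitz bound of order `i + 1` carries the estimate to the limit.
  have hxc : x ∈ closure (interior A) :=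
    hA.closure_interior_eq_closure_of_nonempty_interior hint ▸ subset_closure hx
  obtain ⟨y, hy, hyx⟩ := mem_closure_iff_seq_limit.1 hxc
  have hlim : Filter.Tendsto (fun k => K + K' * ‖x - y k‖) Filter.atTop (nhds (K + K' * 0)) := by
    refine tendsto_const_nhds.add (Filter.Tendsto.const_mul _ ?_)
    have := (tendsto_const_nhds (x := x)).sub hyx
    simpa using this.norm
  refine ge_of_tendsto' (by simpa using hlim) fun k => ?_
  have h3 := h2 x hx (y k) (interior_subset (hy k))
  have h4 := norm_le_norm_add_norm_sub' (iteratedFDeriv ℝ (i + 1) g x)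
    (iteratedFDeriv ℝ (i + 1) g (y k))
  linarith [hin _ (hy k)]

end Derivatives

end TensorSampling

namespace TensorSampling

/-! ### Numerical estimates for the logarithmic factor and the constant 192. -/

section Parameters

variable {n i : ℕ} {δ : ℝ}

lemma four_mul_le_netBase (i : ℕ) : 4 * (i : ℝ) ≤ 2 * (i : ℝ) / Real.log (3 / 2) := by
  have h0 : 0 < Real.log (3 / 2) := Real.log_pos (by norm_num)
  have h1 : Real.log (3 / 2) ≤ 1 / 2 := by
    have := Real.log_le_sub_one_of_pos (x := 3 / 2) (by norm_num)
    linarith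
  rw [le_div_iff₀ h0]
  nlinarith [(Nat.cast_nonneg i : (0 : ℝ) ≤ i)]

lemma half_le_logFactor (hi : 1 ≤ i) (hδ : 0 < δ) (hδ1 : δ ≤ 1) : 1 / 2 ≤ logFactor n i δ := by
  have hi' : (1 : ℝ) ≤ i := by exact_mod_cast hi
  have hK : 1 ≤ (2 * (i : ℝ) / Real.log (3 / 2)) ^ (n * i) :=
    one_le_pow₀ (by linarith [four_mul_le_netBase i])
  have h2 : 2 ≤ 2 * (2 * (i : ℝ) / Real.log (3 / 2)) ^ (n * i) / δ := by
    rw [le_div_iff₀ hδ]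
    linarith
  have := Real.log_le_log two_pos h2
  rw [logFactor]
  linarith [Real.log_two_gt_d9]

/-- With `W = K ^ (n * i)`, the factor 3 yields `W⁻³`: two powers pay for the net, as `1 + 4 i ≤
K²`, and one for `2 ^ i ≤ W`, which needs `n ≥ 1`. -/
lemma net_tail_le (hn : 1 ≤ n) (hi : 1 ≤ i) (hδ : 0 < δ) (hδ1 : δ ≤ 1) {y : ℝ}
    (hy : 3 * logFactor n i δ ≤ y) :
    2 * (1 + 4 * (i : ℝ)) ^ (n * i) * Real.exp (-y) ≤ δ / 2 ^ i := by
  have hi' : (1 : ℝ) ≤ i := by exact_mod_cast hi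
  have hK := four_mul_le_netBase i
  rw [logFactor] at hy
  set K := 2 * (i : ℝ) / Real.log (3 / 2)
  have hK1 : 1 ≤ K := by linarith
  have hq : 0 < 2 * K ^ (n * i) / δ := by positivity
  have hexp : Real.exp (-y) ≤ ((2 * K ^ (n * i) / δ) ^ 3)⁻¹ := by
    rw [Real.exp_neg]
    refine inv_anti₀ (by positivity) ?_
    calc (2 * K ^ (n * i) / δ) ^ 3 = Real.exp (Real.log (2 * K ^ (n * i) / δ)) ^ 3 := by
          rw [Real.exp_log hq]
      _ = Real.exp (3 * Real.log (2 * K ^ (n * i) / δ)) := by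
          rw [← Real.exp_nat_mul]; norm_num
      _ ≤ _ := Real.exp_le_exp.2 hy
  have h1 : (1 + 4 * (i : ℝ)) ^ (n * i) ≤ (K ^ (n * i)) ^ 2 := by
    rw [← pow_mul, mul_comm (n * i) 2, pow_mul K]
    exact pow_le_pow_left₀ (by positivity) (by nlinarith) _
  have h2 : (2 : ℝ) ^ i ≤ K ^ (n * i) :=
    (pow_le_pow_left₀ (by norm_num) (by linarith : (2 : ℝ) ≤ K) i).trans
      (pow_le_pow_right₀ hK1 (Nat.le_mul_of_pos_left i hn))
  have hW : 0 < K ^ (n * i) := by positivity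
  set W := K ^ (n * i)
  calc 2 * (1 + 4 * (i : ℝ)) ^ (n * i) * Real.exp (-y)
      ≤ 2 * W ^ 2 * ((2 * W / δ) ^ 3)⁻¹ := by gcongr
    _ = δ * (δ ^ 2 / 4) / W := by
      field_simp
      norm_num
    _ ≤ δ * 1 / W := by
      gcongr
      nlinarith
    _ ≤ δ / 2 ^ i := by
      rw [mul_one]
      gcongr

/-- A sample size below the population size that is at least the batch size is large enough for
the exponent in Hoeffding's inequality. -/
lemma three_mul_le_of_batch_le {m N : ℕ} {a l : ℝ} (hm : 1 ≤ m) (ha : 0 < a) (hl : 1 / 2 ≤ l)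
    (hN : 192 * l * (a + 1 / (m : ℝ))⁻¹ ≤ N) (hNm : N < m) : 3 * l ≤ N * a / 32 := by
  have hm' : (0 : ℝ) < m := by exact_mod_cast hm
  have hNm' : (N : ℝ) < m := by exact_mod_cast hNm
  have hs : 0 < a + 1 / (m : ℝ) := by positivity
  rw [← div_eq_mul_inv, div_le_iff₀ hs] at hN
  -- The `1 / m` term costs at most `1 ≤ 96 * l`, so `192 = 2 * 96` leaves `N * a ≥ 96 * l`.
  have h1 : (N : ℝ) * (1 / m) ≤ 1 := by
    rw [mul_one_div, div_le_one hm']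
    exact hNm'.le
  linarith

end Parameters

/-! ### From counting to probability, and the union bound over orders. -/

section BatchSize

/-- With a batch size of the stated order, few samples deviate by more than `t`. -/
lemma card_bad_samples_le {n m i : ℕ} (hi : 1 ≤ i) (hm : 1 ≤ m) {B t δ : ℝ} (hB : 0 < B)
    (ht : 0 < t) (hδ : 0 < δ) (hδ1 : δ ≤ 1)
    (A : Fin m → ContinuousMultilinearMap ℝ (fun _ : Fin i => Space n) ℝ) (hA : ∀ j, ‖A j‖ ≤ B)
    {N : ℕ} (hN1 : 1 ≤ N)
    (hN : N = min m ⌈192 * logFactor n i δ * (t ^ 2 / B ^ 2 + 1 / (m : ℝ))⁻¹⌉₊) :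
    (((Finset.powersetCard N Finset.univ).filter fun S : Finset (Fin m) =>
        t < ‖(S.card : ℝ)⁻¹ • ∑ j ∈ S, A j - (m : ℝ)⁻¹ • ∑ j, A j‖).card : ℝ) ≤
      m.choose N * (δ / 2 ^ i) := by
  have hnonneg : 0 ≤ (m.choose N : ℝ) * (δ / 2 ^ i) := by positivity
  have hzero : (∀ S : Finset (Fin m), S.card = N →
      (S.card : ℝ)⁻¹ • ∑ j ∈ S, A j - (m : ℝ)⁻¹ • ∑ j, A j = 0) →
      (((Finset.powersetCard N Finset.univ).filter fun S : Finset (Fin m) =>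
        t < ‖(S.card : ℝ)⁻¹ • ∑ j ∈ S, A j - (m : ℝ)⁻¹ • ∑ j, A j‖).card : ℝ) ≤
      m.choose N * (δ / 2 ^ i) := fun h => by
    rw [Finset.filter_false_of_mem]
    · simpa using hnonneg
    · intro S hS
      rw [h S (Finset.mem_powersetCard_univ.1 hS), norm_zero]
      exact not_lt.2 ht.le
  -- On the zero space all forms of order at least 1 vanish.
  rcases Nat.eq_zero_or_pos n with rfl | hn
  · refine hzero fun S _ => ?_
    ext v
    exact ContinuousMultilinearMap.map_coord_zero _ ⟨0, hi⟩ (Subsingleton.elim _ _)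
  -- A full sample reproduces the mean exactly; otherwise the ceiling is attained.
  rcases (hN.trans_le (min_le_left m _)).eq_or_lt with hNm | hNm
  · refine hzero fun S hS => ?_
    have : S = Finset.univ := by
      rw [← Finset.card_eq_iff_eq_univ, Fintype.card_fin, hS, hNm]
    rw [this]
    simp
  have hNceil : 192 * logFactor n i δ * (t ^ 2 / B ^ 2 + 1 / (m : ℝ))⁻¹ ≤ N := by
    refine (Nat.le_ceil _).trans (Nat.cast_le.2 ?_)
    rcases min_choice m ⌈192 * logFactor n i δ * (t ^ 2 / B ^ 2 + 1 / (m : ℝ))⁻¹⌉₊ with h | h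
    · omega
    · exact (hN.trans h).ge
  have hy := three_mul_le_of_batch_le hm (by positivity) (half_le_logFactor hi hδ hδ1) hNceil hNm
  rw [show N * (t ^ 2 / B ^ 2) / 32 = N * t ^ 2 / (32 * B ^ 2) by field_simp] at hy
  have : Nonempty (Fin m) := ⟨⟨0, hm⟩⟩
  have hdev := card_norm_deviation_le hi A hB ht.le hA hN1
  rw [Fintype.card_fin, finrank_euclideanSpace_fin] at hdev
  refine le_trans (le_of_eq ?_) (hdev.trans
    (mul_le_mul_of_nonneg_left (net_tail_le hn hi hδ hδ1 hy) (by positivity)))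
  congr 2
  refine Finset.filter_congr fun S hS => ?_
  rw [Finset.mem_powersetCard_univ.1 hS]

lemma IsSampleWithoutReplacement.measure_le {Ω : Type*} [MeasurableSpace Ω] {μ : Measure Ω}
    {m N : ℕ} {S : Ω → Finset (Fin m)} (hS : IsSampleWithoutReplacement μ N S) (hNm : N ≤ m)
    (P : Finset (Fin m) → Prop) [DecidablePred P] {q : ℝ}
    (hP : (((Finset.powersetCard N Finset.univ).filter P).card : ℝ) ≤ m.choose N * q) :
    μ {ω | P (S ω)} ≤ ENNReal.ofReal q := by
  have hc : (0 : ℝ) < m.choose N := by exact_mod_cast Nat.choose_pos hNm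
  have hset : {ω | P (S ω)} = ⋃ A ∈ Finset.univ.filter P, {ω | S ω = A} := by
    ext ω
    simp
  have hfil : (Finset.univ.filter P).filter (fun A : Finset (Fin m) => A.card = N) =
      (Finset.powersetCard N Finset.univ).filter P := by
    ext A
    simp [and_comm]
  rw [hset]
  refine (measure_biUnion_finset_le _ _).trans ?_
  rw [Finset.sum_congr rfl fun A _ => hS.measure_eq A, ← Finset.sum_filter, hfil,
    Finset.sum_const, nsmul_eq_mul, ← ENNReal.ofReal_natCast, ← ENNReal.ofReal_natCast,
    ← ENNReal.ofReal_inv_of_pos hc, ← ENNReal.ofReal_mul (by positivity)]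
  refine ENNReal.ofReal_le_ofReal ?_
  rw [← div_eq_mul_inv, div_le_iff₀ hc, mul_comm q]
  exact hP

/-- Union bound: events of probability at most `δ / 2^(k+1)` fail simultaneously with
probability at least `1 - δ`. -/
lemma ofReal_one_sub_le_measure_of_union_bound {Ω : Type*} [MeasurableSpace Ω] (μ : Measure Ω)
    [IsProbabilityMeasure μ] (p : ℕ) {δ : ℝ} (hδ : 0 < δ) (Z : ℕ → Set Ω)
    (hZ : ∀ k < p, μ (Z k) ≤ ENNReal.ofReal (δ / 2 ^ (k + 1))) {G : Set Ω}
    (hG : ∀ ω, (∀ k < p, ω ∉ Z k) → ω ∈ G) : ENNReal.ofReal (1 - δ) ≤ μ G := by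
  -- Geometric weights keep `p` out of the logarithmic factor.
  have hgeom : ∀ q : ℕ, ∑ k ∈ Finset.range q, δ / 2 ^ (k + 1) = δ * (1 - 1 / 2 ^ q) := fun q => by
    induction q with
    | zero => simp
    | succ q ih =>
      rw [Finset.sum_range_succ, ih, pow_succ]
      field_simp
      ring
  have hcover : (Set.univ : Set Ω) ⊆ G ∪ ⋃ k ∈ Finset.range p, Z k := by
    intro ω _
    by_cases h : ∀ k < p, ω ∉ Z k
    · exact Or.inl (hG ω h)
    · push Not at h
      obtain ⟨k, hk, hω⟩ := h
      exact Or.inr (Set.mem_biUnion (Finset.mem_coe.2 (Finset.mem_range.2 hk)) hω)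
  have hbad : μ (⋃ k ∈ Finset.range p, Z k) ≤ ENNReal.ofReal δ := by
    refine (measure_biUnion_finset_le _ _).trans ?_
    refine (Finset.sum_le_sum fun k hk => hZ k (Finset.mem_range.1 hk)).trans ?_
    rw [← ENNReal.ofReal_sum_of_nonneg fun k _ => by positivity, hgeom]
    refine ENNReal.ofReal_le_ofReal (mul_le_of_le_one_right hδ.le ?_)
    have : (0 : ℝ) < 1 / 2 ^ p := by positivity
    linarith
  rw [ENNReal.ofReal_sub _ hδ.le, ENNReal.ofReal_one, tsub_le_iff_right, ← measure_univ (μ := μ)]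
  exact (measure_mono hcover).trans ((measure_union_le _ _).trans (by gcongr))

lemma inexactnessCondition_of_norm_le {n p : ℕ} {κ : ℕ → ℝ} {ε : ℝ} {g : Space n → ℝ}
    {x : Space n} {G : (i : ℕ) → ContinuousMultilinearMap ℝ (fun _ : Fin i => Space n) ℝ}
    (h : ∀ k < p, ‖G (k + 1) - iteratedFDeriv ℝ (k + 1) g x‖ ≤
      κ (k + 1) * ε ^ (((p : ℝ) - ((k + 1 : ℕ) : ℝ) + 1) / (p : ℝ))) :
    InexactnessCondition p κ ε g x G := by
  intro k hk s
  refine (ContinuousMultilinearMap.le_opNorm _ _).trans ?_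
  rw [ContinuousMultilinearMap.curryRight_norm, Finset.prod_const, Finset.card_univ,
    Fintype.card_fin]
  exact mul_le_mul_of_nonneg_right (h k hk) (by positivity)

end BatchSize

end TensorSampling

open TensorSampling in
theorem mainTheorem5 :
    ∃ C : ℝ, 0 < C ∧
      ∀ (n p m : ℕ) (_hp : 1 ≤ p) (_hm : 1 ≤ m)
        (L κ : ℕ → ℝ) (_hL : ∀ i < p, 0 < L i) (_hκ : ∀ i, 1 ≤ i → i ≤ p → 0 < κ i)
        (ε δ : ℝ) (_hε : 0 < ε) (_hδ : 0 < δ) (_hδ1 : δ ≤ 1),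
        ∃ N : ℕ → ℕ,
          (∀ i, 1 ≤ i → i ≤ p →
            1 ≤ N i ∧ N i ≤ m ∧
              N i ≤ ⌈C * TensorSampling.logFactor n i δ *
                TensorSampling.batchOrder p m i (L (i - 1)) (κ i) ε⌉₊) ∧
          ∀ (f : Fin m → TensorSampling.Space n → ℝ) (x₀ : TensorSampling.Space n)
            (_hconv : ConvexOn ℝ Set.univ (TensorSampling.finiteSum f))
            (_hint : (interior
              (TensorSampling.lebesgueSet (TensorSampling.finiteSum f) x₀)).Nonempty)
            (_hdiff : ∀ j, TensorSampling.TimesDifferentiable p (f j))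
            (_hlip : ∀ j, ∀ i ≤ p, TensorSampling.LipschitzDerivOn i (L i) (f j)
              (TensorSampling.lebesgueSet (TensorSampling.finiteSum f) x₀))
            (x : TensorSampling.Space n)
            (_hx : x ∈ TensorSampling.lebesgueSet (TensorSampling.finiteSum f) x₀)
            (Ω : Type*) [MeasurableSpace Ω] (μ : MeasureTheory.Measure Ω)
            [MeasureTheory.IsProbabilityMeasure μ] (S : ℕ → Ω → Finset (Fin m))
            (_hS : ∀ i, 1 ≤ i → i ≤ p →
              TensorSampling.IsSampleWithoutReplacement μ (N i) (S i)),
            ENNReal.ofReal (1 - δ) ≤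
              μ {ω | TensorSampling.InexactnessCondition p κ ε (TensorSampling.finiteSum f) x
                (fun i => TensorSampling.sampledDeriv f (S i ω) i x)} := by
  classical
  refine ⟨192, by norm_num, ?_⟩
  intro n p m hp hm L κ hL hκ ε δ hε hδ hδ1
  -- The tolerated error at order `i`; its square over `L (i - 1) ^ 2` is the first term inside
  -- `batchOrder`.
  let t : ℕ → ℝ := fun i => κ i * ε ^ (((p : ℝ) - (i : ℝ) + 1) / (p : ℝ))
  have ht : ∀ i, 1 ≤ i → i ≤ p → 0 < t i := fun i h1 h2 =>
    mul_pos (hκ i h1 h2) (Real.rpow_pos_of_pos hε _)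
  have hm' : (0 : ℝ) < m := by exact_mod_cast hm
  have horder : ∀ i, batchOrder p m i (L (i - 1)) (κ i) ε =
      (t i ^ 2 / L (i - 1) ^ 2 + 1 / (m : ℝ))⁻¹ := fun i => by
    rw [batchOrder, mul_pow, ← Real.rpow_mul_natCast hε.le]
    congr 5
    push_cast
    ring
  let N : ℕ → ℕ := fun i =>
    min m ⌈192 * logFactor n i δ * batchOrder p m i (L (i - 1)) (κ i) ε⌉₊
  have hN1 : ∀ i, 1 ≤ i → i ≤ p → 1 ≤ N i := fun i h1 h2 => by
    refine le_min hm (Nat.one_le_iff_ne_zero.2 (Nat.ceil_pos.2 ?_).ne')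
    have hl := half_le_logFactor (n := n) h1 hδ hδ1
    rw [horder]
    positivity
  refine ⟨N, fun i h1 h2 => ⟨hN1 i h1 h2, min_le_left _ _, min_le_right _ _⟩, ?_⟩
  intro f x₀ hconv hint hdiff hlip x hx Ω _ μ _ S hS
  have hconvA : Convex ℝ (lebesgueSet (finiteSum f) x₀) := by
    simpa [lebesgueSet] using hconv.convex_le (finiteSum f x₀)
  have hmean : ∀ i ≤ p, iteratedFDeriv ℝ i (finiteSum f) x =
      (m : ℝ)⁻¹ • ∑ j, iteratedFDeriv ℝ i (f j) x := fun i hi =>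
    iteratedFDeriv_smul_sum _ f hdiff i hi x
  let P : ℕ → Finset (Fin m) → Prop := fun k A =>
    t (k + 1) < ‖(A.card : ℝ)⁻¹ • ∑ j ∈ A, iteratedFDeriv ℝ (k + 1) (f j) x -
      (m : ℝ)⁻¹ • ∑ j, iteratedFDeriv ℝ (k + 1) (f j) x‖
  refine ofReal_one_sub_le_measure_of_union_bound μ p hδ
    (fun k => {ω | P k (S (k + 1) ω)}) (fun k hk => ?_) fun ω hω => ?_
  · refine (hS (k + 1) (by omega) hk).measure_le (min_le_left _ _) (P k) ?_
    refine card_bad_samples_le (by omega) hm (hL k hk) (ht (k + 1) (by omega) hk) hδ hδ1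
      (fun j => iteratedFDeriv ℝ (k + 1) (f j) x) (fun j => ?_) (hN1 (k + 1) (by omega) hk) ?_
    · exact norm_iteratedFDeriv_succ_le hconvA hint (hL k hk).le (hlip j k hk.le)
        (hlip j (k + 1) hk) hx
    · simp only [N, horder, Nat.add_sub_cancel]
  · rw [Set.mem_ofPred_eq]
    refine inexactnessCondition_of_norm_le (G := fun i => sampledDeriv f (S i ω) i x)
      fun k hk => ?_
    have h := hω k hk
    rw [hmean (k + 1) hk]
    exact not_lt.1 h
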